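/- Let $\mathcal X\subseteq\mathbb R^{d_x}$ be Borel and $\mathcal Y\subseteq\mathbb R^{d_y}$ open and connected (for instance $\mathcal Y=\mathbb R^{d_y}$). Let $r_x$ be a probability density on $\mathcal X$, and let $p(\mathbf y|\mathbf x)$ and $r(\mathbf y|\mathbf x)$ be conditional probability densities on $\mathcal Y$ given $\mathbf x\in\mathcal X$, jointly measurable, strictly positive, and differentiable in $\mathbf y$. Write $r_{xy}(\mathbf x,\mathbf y)=r(\mathbf y|\mathbf x)r_x(\mathbf x)$. Let $l\colon\mathcal Y\times\mathcal Y\to\mathbb R$ be a positive definite kernel with reproducing kernel Hilbert space (RKHS) $\mathcal F_l$, differentiable in the sense that $\mathbf y\mapsto l(\mathbf y,\cdot)\in\mathcal F_l$ is differentiable, and let $\mathcal F_l^{d_y}$ carry the inner product $\langle \mathbf a,\mathbf b\rangle=\sum_i\langle a_i,b_i\rangle_{\mathcal F_l}$. Let $K\colon\mathcal X\times\mathcal X\to\mathcal L(\mathcal F_l^{d_y})$ be a positive definite operator-valued kernel, with RKHS $\mathcal F_K$ of functions $\mathcal X\to\mathcal F_l^{d_y}$, and let $K_{\mathbf x}\colon\mathcal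 F_l^{d_y}\to\mathcal F_K$ be the adjoint of the evaluation $f\mapsto f(\mathbf x)$. For a conditional density $q\in\{p,r\}$ put $$\xi_{q|\mathbf x}(\mathbf y,\cdot)=l(\mathbf y,\cdot)\,\nabla_{\mathbf y}\log q(\mathbf y|\mathbf x)+\nabla_{\mathbf y}l(\mathbf y,\cdot)\in\mathcal F_l^{d_y}.$$ A kernel on a set $S$ with RKHS $\mathcal F$ of functions $S\to\mathcal Z$ is called $C_0$-universal if every $f\in\mathcal F$ is continuous with $\|f(s)\|\to0$ as $\|s\|\to\infty$, and $\mathcal F$ is a dense subspace of $L^2(S,\mu;\mathcal Z)$ for every Borel probability measure $\mu$ on $S$. If $\mathcal Y\neq\mathbb R^{d_y}$, assume in addition the following boundary condition: for $r_x$-almost every $\mathbf x$, $\mathbb E_{\mathbf y\sim r(\cdot|\mathbf x)}\langle\xi_{r|\mathbf x}(\mathbf y,\cdot),\mathbf f\rangle_{\mathcal F_l^{d_y}}=0$ for all $\mathbf f\in\mathcal F_l^{d_y}$ for which this expectation exists (equivalently, $\int_{\mathcal Y}\operatorname{div}_{\mathbf y}(r(\mathbf y|\mathbf x)\mathbf f(\mathbf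 y))\,d\mathbf y=0$). Assume that, for $r_x$-almost every $\mathbf x$, the expectation $\mathbf g_{p,r}(\mathbf w|\mathbf x)=\mathbb E_{\mathbf y\sim r(\cdot|\mathbf x)}\,\xi_{p|\mathbf x}(\mathbf y,\mathbf w)$ exists for all $\mathbf w\in\mathcal Y$ and defines an element $\mathbf g_{p,r}(\cdot|\mathbf x)$ of $\mathcal F_l^{d_y}$, and that 1. $K$ and $l$ are $C_0$-universal; 2. $r_x\text{-}\operatorname{ess\,sup}_{\mathbf x}\ \mathbb E_{\mathbf y\sim r(\cdot|\mathbf x)}\big\|\nabla_{\mathbf y}\log\frac{p(\mathbf y|\mathbf x)}{r(\mathbf y|\mathbf x)}\big\|_2^2<\infty$; 3. $\int_{\mathcal X}\|\mathbf g_{p,r}(\cdot|\mathbf x)\|^2_{\mathcal F_l^{d_y}}\,r_x(\mathbf x)\,d\mathbf x<\infty$; 4. $\mathbb E_{(\mathbf x,\mathbf y)\sim r_{xy}}\|K_{\mathbf x}\xi_{p|\mathbf x}(\mathbf y,\cdot)\|_{\mathcal F_K}<\infty$ (Bochner integrability). Then the Kernel Conditional Stein Discrepancy $$D_p(r)=\big\|\mathbb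 E_{(\mathbf x,\mathbf y)\sim r_{xy}}K_{\mathbf x}\xi_{p|\mathbf x}(\mathbf y,\cdot)\big\|^2_{\mathcal F_K}$$ is zero if and only if, for $r_x$-almost every $\mathbf x$, $p(\mathbf y|\mathbf x)=r(\mathbf y|\mathbf x)$ for all $\mathbf y\in\mathcal Y$. -/

import Mathlib

namespace KCSD

open MeasureTheory Filter Topology
open scoped ENNReal

/-- The Euclidean space `ℝ^d`. -/
abbrev E (d : ℕ) : Type := EuclideanSpace ℝ (Fin d)

/-- The Hilbert space `H^d` with inner product `⟪a, b⟫ = ∑ i, ⟪a i, b i⟫`. -/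
abbrev PiSpace (H : Type*) (d : ℕ) : Type _ := PiLp 2 fun _ : Fin d => H

/-- Lebesgue measure on a subset of `ℝ^d`. -/
noncomputable def lebesgueOn {d : ℕ} (S : Set (E d)) : Measure S :=
  Measure.comap Subtype.val volume

section Densities

variable {dx dy : ℕ} {X : Set (E dx)}

/-- `f` is a probability density function on `X`. -/
structure IsDensity (f : X → ℝ) : Prop where
  measurable : Measurable f
  nonneg : ∀ x, 0 ≤ f x
  lintegral_eq_one : ∫⁻ x, ENNReal.ofReal (f x) ∂(lebesgueOn X) = 1

/-- `q x y = q(y|x)` is a strictly positive conditional probability density function on `Y`,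
differentiable in `y`. Values of `q x` outside `Y` are irrelevant. -/
structure IsCondDensity (Y : Set (E dy)) (q : X → E dy → ℝ) : Prop where
  measurable : Measurable fun z : X × Y => q z.1 z.2
  pos : ∀ x, ∀ y ∈ Y, 0 < q x y
  differentiableAt : ∀ x, ∀ y ∈ Y, DifferentiableAt ℝ (q x) y
  lintegral_eq_one : ∀ x, ∫⁻ y : Y, ENNReal.ofReal (q x y) ∂(lebesgueOn Y) = 1

/-- The law `r_x` of the covariate. -/
noncomputable def marginal (rx : X → ℝ) : Measure X :=
  (lebesgueOn X).withDensity fun x => ENNReal.ofReal (rx x)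

/-- The conditional law `q(· | x)` on `Y`. -/
noncomputable def conditional (Y : Set (E dy)) (q : X → E dy → ℝ) (x : X) : Measure Y :=
  (lebesgueOn Y).withDensity fun y => ENNReal.ofReal (q x y)

/-- The joint law on `X × Y`, with density `r(y|x) r_x(x)`. -/
noncomputable def joint (Y : Set (E dy)) (rx : X → ℝ) (r : X → E dy → ℝ) : Measure (X × Y) :=
  ((lebesgueOn X).prod (lebesgueOn Y)).withDensity fun z => ENNReal.ofReal (r z.1 z.2 * rx z.1)

end Densities

section Kernels

/-- The reproducing kernel of the RKHS `H` of `V`-valued functions on `S ⊆ ℝ^d` is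
`C₀`-universal: every element of `H` is a continuous function vanishing at infinity, and `H` is
a dense subspace of `L²(S, μ; V)` for every Borel probability measure `μ` on `S`. -/
def IsC0Universal {d : ℕ} {S : Set (E d)} {V : Type*} [NormedAddCommGroup V]
    [InnerProductSpace ℝ V] (H : Type*) [NormedAddCommGroup H] [InnerProductSpace ℝ H]
    [RKHS ℝ H S V] : Prop :=
  (∀ f : H, Continuous (f : S → V) ∧ Tendsto (f : S → V) (Bornology.cobounded S) (𝓝 0)) ∧
  ∀ μ : Measure S, IsProbabilityMeasure μ →
    (∀ f : H, MemLp (f : S → V) 2 μ) ∧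
    ∀ g : S → V, MemLp g 2 μ → ∀ ε : ℝ≥0∞, ε ≠ 0 → ∃ f : H, eLpNorm (g - (f : S → V)) 2 μ ≤ ε

variable {dx dy : ℕ} {X : Set (E dx)} {Y : Set (E dy)}
variable (Hl : Type*) [NormedAddCommGroup Hl] [InnerProductSpace ℝ Hl] [CompleteSpace Hl]
  [RKHS ℝ Hl Y ℝ]

open Classical in
/-- The canonical feature map `y ↦ l(y, ·)` of the RKHS `Hl` with real-valued kernel `l` on `Y`
(set to `0` outside `Y`, so that it can be differentiated in `ℝ^dy` at points of the open set
`Y`). -/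
noncomputable def featureMap (y : E dy) : Hl :=
  if h : y ∈ Y then RKHS.kerFun Hl (⟨y, h⟩ : Y) (1 : ℝ) else 0

/-- The kernel is differentiable: `y ↦ l(y, ·)` is differentiable on `Y` as an `Hl`-valued map.
Its partial derivatives are then the functions `∂_{y_i} l(y, ·)`, which thus lie in `Hl`. -/
def IsDifferentiableKernel : Prop :=
  ∀ y ∈ Y, DifferentiableAt ℝ (featureMap Hl) y

/-- The conditional score `∇_y log q(y|x)`. -/
noncomputable def score (q : X → E dy → ℝ) (x : X) (y : E dy) : E dy :=
  gradient (fun y' => Real.log (q x y')) y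

/-- `ξ_{q|x}(y, ·) = l(y, ·) ∇_y log q(y|x) + ∇_y l(y, ·)`, an element of `Hl^dy`. -/
noncomputable def xi (q : X → E dy → ℝ) (x : X) (y : E dy) : PiSpace Hl dy :=
  WithLp.toLp 2 fun i =>
    score q x y i • featureMap Hl y +
      fderiv ℝ (featureMap Hl) y (EuclideanSpace.single i (1 : ℝ))

/-- `g x` is the conditional Stein witness function `g_{p,r}(· | x)`, an element of `Hl^dy`:
`g_{p,r}(w | x) = E_{y ∼ r(·|x)} ξ_{p|x}(y, w)` for all `w`, for `r_x`-almost every `x`. -/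
def IsSteinWitness (p r : X → E dy → ℝ) (rx : X → ℝ) (g : X → PiSpace Hl dy) : Prop :=
  ∀ᵐ x ∂(marginal rx), ∀ (w : Y) (i : Fin dy),
    Integrable (fun y : Y => (xi Hl p x y i : Hl) w) (conditional Y r x) ∧
    (g x i : Hl) w = ∫ y : Y, (xi Hl p x y i : Hl) w ∂(conditional Y r x)

/-- For `r_x`-almost every `x`, the Stein identity `E_{y ∼ r(·|x)} (T f)(y) = 0` of
`r(·|x)` with its own Langevin-Stein operator
`(T f)(y) = ⟪∇_y log r(y|x), f(y)⟫ + ∑ i, ∂_i f_i(y) = ⟪ξ_{r|x}(y, ·), f⟫`,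
for every `f` in `Hl^dy` for which the expectation exists. Equivalently, the integral over `Y` of
the divergence of `r(·|x) f` is zero: no mass flows through the boundary of `Y`. -/
def SteinIdentity (r : X → E dy → ℝ) (rx : X → ℝ) : Prop :=
  ∀ᵐ x ∂(marginal rx), ∀ f : PiSpace Hl dy,
    Integrable (fun y : Y => inner ℝ (xi Hl r x y) f) (conditional Y r x) →
    ∫ y : Y, inner ℝ (xi Hl r x y) f ∂(conditional Y r x) = 0

variable (HK : Type*) [NormedAddCommGroup HK] [InnerProductSpace ℝ HK] [CompleteSpace HK]
  [RKHS ℝ HK X (PiSpace Hl dy)]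

/-- The Kernel Conditional Stein Discrepancy
`D_p(r) = ‖E_{(x, y) ∼ r_xy} K_x ξ_{p|x}(y, ·)‖²`. -/
noncomputable def kcsd (p r : X → E dy → ℝ) (rx : X → ℝ) : ℝ :=
  ‖∫ z : X × Y, RKHS.kerFun HK z.1 (xi Hl p z.1 z.2) ∂(joint Y rx r)‖ ^ 2

end Kernels

end KCSD

/-! Write `δ = ∇_y log (p/r)`. Pairing the mean embedding with `h` in `HK` gives `E_x E_{y|x} ⟪ξ_p,
h x⟫` (`inner_integral_kerFun_xi`). The terms `∇_y l` cancel in `ξ_p - ξ_r = l(y, ·) δ`, and the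
Stein identity of `r(·|x)` removes `ξ_r`. Hence the witness is `g x = E_{y|x} l(y, ·) δ`, and the
pairing equals `E_x ⟪g x, h x⟫`.

If the discrepancy is zero, `g` is orthogonal to `HK`, which is dense in `L²(r_x)`, so `g = 0`
almost everywhere. For such `x`, each component of `δ` is orthogonal to `Hl`, which is dense in
`L²(r(·|x))`, so `δ = 0` almost everywhere. Then `log (p/r)` is constant on the connected set `Y`
(`eq_of_ae_fderiv_eq_zero`), and normalisation makes the constant zero. Conversely, `p = r` turns
every pairing into an instance of the Stein identity.

On the whole space the Stein identity is a theorem (`steinIdentity_univ`): the integral of `div (r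
f)` vanishes. The densities are merely differentiable, so the divergence theorem used requires no
continuity of the derivative. -/

namespace KCSD

open MeasureTheory Filter Topology
open scoped ENNReal

/-! ### Divergence theorem on the whole space. -/

section Divergence

/-- The integral over `ℝⁿ` of the divergence of a compactly supported, everywhere differentiable
vector field is zero. -/
theorem integral_sum_fderiv_eq_zero_of_hasCompactSupport {n : ℕ} (F : Fin n → (Fin n → ℝ) → ℝ)
    (hF : ∀ i, Differentiable ℝ (F i)) (hc : ∀ i, HasCompactSupport (F i))
    (hi : Integrable fun y => ∑ i, fderiv ℝ (F i) y (Pi.single i 1)) :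
    ∫ y, ∑ i, fderiv ℝ (F i) y (Pi.single i 1) = 0 := by
  cases n with
  | zero => simp
  | succ n =>
    have hM : ∃ M : ℝ, 0 ≤ M ∧ ∀ i, ∀ y, M < ‖y‖ → F i y = 0 ∧ fderiv ℝ (F i) y = 0 := by
      have h : IsCompact (⋃ i, tsupport (F i)) := isCompact_iUnion hc
      obtain ⟨M, hM⟩ := h.isBounded.exists_norm_le
      refine ⟨max M 0, le_max_right _ _, fun i y hy => ?_⟩
      have hy' : y ∉ tsupport (F i) := fun hmem =>
        absurd (hM y (Set.mem_iUnion.2 ⟨i, hmem⟩)) (not_le.2 ((le_max_left _ _).trans_lt hy))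
      refine ⟨image_eq_zero_of_notMem_tsupport hy', ?_⟩
      exact image_eq_zero_of_notMem_tsupport fun h => hy' (tsupport_fderiv_subset ℝ h)
    obtain ⟨M, hM0, hM⟩ := hM
    -- The norm here is the sup norm, so the box contains the ball of radius `M`; the extra `1` puts
    -- its faces strictly outside the supports.
    set a : Fin (n + 1) → ℝ := fun _ => -(M + 1)
    set b : Fin (n + 1) → ℝ := fun _ => M + 1
    have hab : a ≤ b := fun i => by simp only [a, b]; linarith
    have key := integral_divergence_of_hasFDerivAt_off_countable' a b hab F
      (fun i y => fderiv ℝ (F i) y) ∅ Set.countable_empty (fun i => (hF i).continuous.continuousOn)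
      (fun x _ i => (hF i x).hasFDerivAt) hi.integrableOn
    rw [setIntegral_eq_integral_of_forall_compl_eq_zero] at key
    · rw [key]
      refine Finset.sum_eq_zero fun i _ => ?_
      have h1 : ∀ (c : ℝ) (x : Fin n → ℝ), M < |c| → F i (i.insertNth c x) = 0 := by
        intro c x hcM
        refine (hM i _ (hcM.trans_le ?_)).1
        simpa using norm_le_pi_norm (i.insertNth c x : Fin (n + 1) → ℝ) i
      have h2 : M < |M + 1| := by rw [abs_of_nonneg] <;> linarith
      have h3 : M < |-(M + 1)| := by rwa [abs_neg]
      simp only [a, b, h1 _ _ h2, h1 _ _ h3, integral_zero, sub_self]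
    · intro y hy
      refine Finset.sum_eq_zero fun i _ => ?_
      rw [(hM i y ?_).2]
      · simp
      · by_contra hle
        refine hy ⟨fun j => ?_, fun j => ?_⟩ <;>
        · have := (norm_le_pi_norm y j).trans (not_lt.1 hle)
          rw [Real.norm_eq_abs, abs_le] at this
          simp only [a, b]
          linarith

/-- Transport from `Fin d → ℝ` along the measure-preserving identification with Euclidean space. -/
theorem integral_divergence_eq_zero_of_hasCompactSupport {d : ℕ} (F : Fin d → E d → ℝ)
    (hF : ∀ i, Differentiable ℝ (F i)) (hc : ∀ i, HasCompactSupport (F i))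
    (hi : Integrable fun y => ∑ i, fderiv ℝ (F i) y (EuclideanSpace.single i 1)) :
    ∫ y, ∑ i, fderiv ℝ (F i) y (EuclideanSpace.single i 1) = 0 := by
  let T : (Fin d → ℝ) ≃L[ℝ] E d := (EuclideanSpace.equiv (Fin d) ℝ).symm
  have hT : MeasurePreserving T := PiLp.volume_preserving_toLp (Fin d)
  have hTe : MeasurableEmbedding T := T.toHomeomorph.measurableEmbedding
  have hfd : ∀ i v, fderiv ℝ (F i ∘ T) v (Pi.single i 1)
      = fderiv ℝ (F i) (T v) (EuclideanSpace.single i 1) := by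
    intro i v
    rw [fderiv_comp v (hF i _) T.differentiableAt, T.fderiv]
    rfl
  have key := integral_sum_fderiv_eq_zero_of_hasCompactSupport (fun i => F i ∘ T)
    (fun i => (hF i).comp T.differentiable)
    (fun i => (hc i).comp_homeomorph T.toHomeomorph) (by
      simp only [hfd]
      exact (hT.integrable_comp_emb hTe).2 hi)
  simp only [hfd] at key
  rw [← hT.integral_comp hTe]
  exact key

/-- The integral over `ℝ^d` of the divergence of an everywhere differentiable vector field is zero
if the field and its divergence are integrable. -/
theorem integral_divergence_eq_zero {d : ℕ} (F : Fin d → E d → ℝ)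
    (hF : ∀ i, Differentiable ℝ (F i)) (hFi : ∀ i, Integrable (F i))
    (hi : Integrable fun y => ∑ i, fderiv ℝ (F i) y (EuclideanSpace.single i 1)) :
    ∫ y, ∑ i, fderiv ℝ (F i) y (EuclideanSpace.single i 1) = 0 := by
  let φ : ContDiffBump (0 : E d) := ⟨1, 2, one_pos, one_lt_two⟩
  have hφ1 : ContDiff ℝ 1 φ := φ.contDiff
  have hφd : Differentiable ℝ φ := hφ1.differentiable one_ne_zero
  have hDc : Continuous (fderiv ℝ φ) := hφ1.continuous_fderiv one_ne_zero
  obtain ⟨C, hC⟩ : ∃ C, ∀ y, ‖fderiv ℝ φ y‖ ≤ C :=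
    (φ.hasCompactSupport.fderiv ℝ).exists_bound_of_continuous hDc
  let c : ℕ → ℝ := fun n => ((n : ℝ) + 1)⁻¹
  have hc0 : ∀ n, 0 < c n := fun n => by positivity
  have hc1 : ∀ n, c n ≤ 1 := fun n => inv_le_one_of_one_le₀ (by simp)
  have hclim : Tendsto c atTop (𝓝 0) := by
    simpa [c, one_div] using tendsto_one_div_add_atTop_nhds_zero_nat (𝕜 := ℝ)
  let e : Fin d → E d := fun i => EuclideanSpace.single i 1
  have he : ∀ i, ‖e i‖ = 1 := fun i => by simp [e]
  let D : E d → ℝ := fun y => ∑ i, fderiv ℝ (F i) y (e i)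
  -- The divergence of the cut-off field `φ (c n • y) F`. The cutoff tends to `1` and its gradient
  -- carries a factor `c n → 0`, so dominated convergence applies with `F` and its divergence
  -- integrable.
  let G : ℕ → E d → ℝ := fun n y =>
    φ (c n • y) * D y + ∑ i, c n * fderiv ℝ φ (c n • y) (e i) * F i y
  have hderiv : ∀ n i y, fderiv ℝ (fun z => φ (c n • z) * F i z) y (e i)
      = φ (c n • y) * fderiv ℝ (F i) y (e i) + c n * fderiv ℝ φ (c n • y) (e i) * F i y := by
    intro n i y
    have h1 : HasFDerivAt (fun z : E d => c n • z) (c n • ContinuousLinearMap.id ℝ (E d)) y :=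
      (hasFDerivAt_id y).const_smul (c n)
    have h2 := (hφd (c n • y)).hasFDerivAt.comp y h1
    have h3 := h2.mul (hF i y).hasFDerivAt
    rw [HasFDerivAt.fderiv (f := fun z => φ (c n • z) * F i z) h3]
    simp
    ring
  have hG : ∀ n y, ∑ i, fderiv ℝ (fun z => φ (c n • z) * F i z) y (e i) = G n y := by
    intro n y
    simp only [hderiv, G, D, Finset.sum_add_distrib, Finset.mul_sum]
  have hbound : ∀ n y, ‖G n y‖ ≤ ‖D y‖ + ∑ i, C * ‖F i y‖ := by
    intro n y
    refine (norm_add_le _ _).trans (add_le_add ?_ ((norm_sum_le _ _).trans ?_))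
    · rw [norm_mul, Real.norm_eq_abs, abs_of_nonneg φ.nonneg]
      exact mul_le_of_le_one_left (norm_nonneg _) φ.le_one
    · refine Finset.sum_le_sum fun i _ => ?_
      rw [norm_mul]
      refine mul_le_mul_of_nonneg_right ?_ (norm_nonneg _)
      rw [norm_mul, Real.norm_eq_abs, abs_of_pos (hc0 n)]
      refine (mul_le_of_le_one_left (norm_nonneg _) (hc1 n)).trans ?_
      refine ((fderiv ℝ φ (c n • y)).le_opNorm _).trans ?_
      rw [he, mul_one]
      exact hC _
  have hmeas : ∀ n, AEStronglyMeasurable (G n) := by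
    intro n
    have hs : Continuous fun y : E d => c n • y := continuous_const_smul _
    refine ((φ.continuous.comp hs).aestronglyMeasurable.mul hi.aestronglyMeasurable).add ?_
    refine Finset.aestronglyMeasurable_fun_sum _ fun i _ => ?_
    refine AEStronglyMeasurable.mul ?_ (hFi i).aestronglyMeasurable
    exact (continuous_const.mul ((hDc.comp hs).clm_apply continuous_const)).aestronglyMeasurable
  have hbi : Integrable fun y => ‖D y‖ + ∑ i, C * ‖F i y‖ :=
    hi.norm.add (integrable_finsetSum _ fun i _ => (hFi i).norm.const_mul C)
  have hGi : ∀ n, Integrable (G n) := fun n =>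
    hbi.mono' (hmeas n) (Eventually.of_forall (hbound n))
  have hzero : ∀ n, ∫ y, G n y = 0 := by
    intro n
    have := integral_divergence_eq_zero_of_hasCompactSupport
      (fun i z => φ (c n • z) * F i z)
      (fun i => (hφd.comp (differentiable_id.const_smul (c n))).mul (hF i))
      (fun i => (φ.hasCompactSupport.comp_homeomorph
        (Homeomorph.smulOfNeZero (c n) (hc0 n).ne')).mul_right) (by
          refine (hGi n).congr (Eventually.of_forall fun y => (hG n y).symm))
    rw [← this]
    exact integral_congr_ae (Eventually.of_forall fun y => (hG n y).symm)
  have hlim : ∀ y, Tendsto (fun n => G n y) atTop (𝓝 (D y)) := by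
    intro y
    have h0 : Tendsto (fun n => c n • y) atTop (𝓝 0) := by
      simpa using hclim.smul_const y
    have h1 : Tendsto (fun n => φ (c n • y)) atTop (𝓝 1) := by
      have := (φ.continuous.tendsto 0).comp h0
      rwa [φ.one_of_mem_closedBall (Metric.mem_closedBall_self φ.rIn_pos.le)] at this
    have h2 : ∀ i, Tendsto (fun n => c n * fderiv ℝ φ (c n • y) (e i) * F i y) atTop (𝓝 0) := by
      intro i
      have h3 : Tendsto (fun n => fderiv ℝ φ (c n • y) (e i)) atTop (𝓝 (fderiv ℝ φ 0 (e i))) :=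
        ((hDc.clm_apply continuous_const).tendsto 0).comp h0
      simpa using (hclim.mul h3).mul_const (F i y)
    simpa [G] using (h1.mul_const (D y)).add (tendsto_finsetSum Finset.univ fun i _ => h2 i)
  have := tendsto_integral_of_dominated_convergence _ hmeas hbi
    (fun n => Eventually.of_forall (hbound n)) (Eventually.of_forall hlim)
  simp only [hzero] at this
  exact (tendsto_nhds_unique this tendsto_const_nhds)

end Divergence

/-- A function that is differentiable at every point of a connected open set is constant there if
its derivative vanishes almost everywhere. -/
theorem eq_of_ae_fderiv_eq_zero {V : Type*} [NormedAddCommGroup V] [NormedSpace ℝ V]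
    [MeasurableSpace V] [BorelSpace V] [FiniteDimensional ℝ V]
    (μ : Measure V) [μ.IsAddHaarMeasure] {U : Set V} (hU : IsOpen U) (hUc : IsPreconnected U)
    {f : V → ℝ} (hf : ∀ y ∈ U, DifferentiableAt ℝ f y)
    (h0 : ∀ᵐ y ∂μ, y ∈ U → fderiv ℝ f y = 0) {x y : V} (hx : x ∈ U) (hy : y ∈ U) :
    f x = f y := by
  refine hU.is_const_of_fderiv_eq_zero (𝕜 := ℝ) hUc
    (fun z hz => (hf z hz).differentiableWithinAt) (fun z hz => ?_) hx hy
  obtain ⟨ε, hε, hball⟩ := Metric.isOpen_iff.1 hU z hz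
  -- The segment from `z` to `z + v` may lie inside the exceptional null set. By Fubini, the
  -- parallel segment from almost every nearby `w` meets that set in a null set of parameters, so
  -- the fundamental theorem of calculus gives `f (w + v) = f w`; continuity then reaches `w = z`.
  suffices hloc : ∀ v : V, ‖v‖ < ε / 2 → f (z + v) = f z by
    have : f =ᶠ[𝓝 z] fun _ => f z := by
      filter_upwards [Metric.ball_mem_nhds z (half_pos hε)] with w hw
      have := hloc (w - z) (by simpa [dist_eq_norm] using hw)
      simpa using this
    rw [this.fderiv_eq]
    simp
  intro v hv
  have hmem : ∀ w ∈ Metric.ball z (ε / 2), ∀ t ∈ Set.Icc (0 : ℝ) 1, w + t • v ∈ U := by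
    intro w hw t ht
    apply hball
    rw [Metric.mem_ball, dist_eq_norm] at hw ⊢
    have : ‖t • v‖ ≤ ‖v‖ := by
      rw [norm_smul, Real.norm_eq_abs, abs_of_nonneg ht.1]
      exact mul_le_of_le_one_left (norm_nonneg _) ht.2
    calc ‖w + t • v - z‖ = ‖(w - z) + t • v‖ := by congr 1; abel
      _ ≤ ‖w - z‖ + ‖t • v‖ := norm_add_le _ _
      _ < ε := by linarith
  have hD : MeasurableSet {y | y ∈ U → fderiv ℝ f y = 0} := by
    have : {y | y ∈ U → fderiv ℝ f y = 0} = Uᶜ ∪ fderiv ℝ f ⁻¹' {0} := by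
      ext; simp [imp_iff_not_or]
    rw [this]
    exact hU.measurableSet.compl.union (measurable_fderiv ℝ f (measurableSet_singleton 0))
  have hm : Measurable fun q : V × ℝ => q.1 + q.2 • v := by fun_prop
  have h1 : ∀ᵐ w ∂μ, ∀ᵐ t ∂(volume : Measure ℝ),
      w + t • v ∈ U → fderiv ℝ f (w + t • v) = 0 := by
    have h2 : ∀ᵐ t ∂(volume : Measure ℝ), ∀ᵐ w ∂μ,
        w + t • v ∈ U → fderiv ℝ f (w + t • v) = 0 :=
      Eventually.of_forall fun t => (eventually_add_right_iff μ (t • v)).2 h0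
    exact (Measure.ae_ae_comm (p := fun (w : V) (t : ℝ) =>
      w + t • v ∈ U → fderiv ℝ f (w + t • v) = 0) (hm hD)).2 h2
  have h3 : ∀ᵐ w ∂μ, w ∈ Metric.ball z (ε / 2) → f (w + v) - f w = 0 := by
    filter_upwards [h1] with w hw hwb
    have hd : ∀ t ∈ Set.uIcc (0 : ℝ) 1,
        HasDerivAt (fun t : ℝ => f (w + t • v)) (fderiv ℝ f (w + t • v) v) t := by
      intro t ht
      rw [Set.uIcc_of_le zero_le_one] at ht
      have hl : HasDerivAt (fun t : ℝ => w + t • v) v t := by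
        simpa using ((hasDerivAt_id t).smul_const v).const_add w
      exact (hf _ (hmem w hwb t ht)).hasFDerivAt.comp_hasDerivAt t hl
    have hz : ∀ᵐ t ∂(volume : Measure ℝ), t ∈ Set.uIoc (0 : ℝ) 1 →
        fderiv ℝ f (w + t • v) v = 0 := by
      filter_upwards [hw] with t ht hti
      rw [Set.uIoc_of_le zero_le_one] at hti
      rw [ht (hmem w hwb t ⟨hti.1.le, hti.2⟩)]
      simp
    have hii : IntervalIntegrable (fun t : ℝ => fderiv ℝ f (w + t • v) v) volume 0 1 :=
      (intervalIntegrable_const (c := (0 : ℝ))).congr_ae (by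
        rw [EventuallyEq, ae_restrict_iff' measurableSet_uIoc]
        filter_upwards [hz] with t ht hti using (ht hti).symm)
    have hftc := intervalIntegral.integral_eq_sub_of_hasDerivAt hd hii
    rw [intervalIntegral.integral_congr_ae (g := fun _ => (0 : ℝ)) hz] at hftc
    simpa using hftc.symm
  have h4 : Set.EqOn (fun w => f (w + v) - f w) (fun _ => 0) (Metric.ball z (ε / 2)) := by
    refine Measure.eqOn_open_of_ae_eq (μ := μ) ?_ Metric.isOpen_ball ?_ continuousOn_const
    · rw [EventuallyEq, ae_restrict_iff' measurableSet_ball]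
      exact h3
    · intro w hw
      have ha := hmem w hw 1 (by simp)
      have hb := hmem w hw 0 (by simp)
      rw [one_smul] at ha
      rw [zero_smul, add_zero] at hb
      refine (ContinuousAt.sub ?_ (hf w hb).continuousAt).continuousWithinAt
      exact ContinuousAt.comp (f := fun w => w + v) (hf _ ha).continuousAt (by fun_prop)
  have := h4 (Metric.mem_ball_self (half_pos hε))
  simpa [sub_eq_zero] using this

/-! ### Consequences of universality. -/

section Kernels

/-- A function that is square integrable for every probability measure is bounded. -/
theorem exists_bound_of_forall_memLp {S V : Type*} [MeasurableSpace S] [MeasurableSingletonClass S]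
    [NormedAddCommGroup V] {f : S → V}
    (hf : ∀ μ : Measure S, IsProbabilityMeasure μ → MemLp f 2 μ) : ∃ C, ∀ s, ‖f s‖ ≤ C := by
  by_contra! h
  choose s hs using fun n : ℕ => h ((2 : ℝ) ^ (n + 1))
  -- The atom at `s n` has mass `2⁻⁽ⁿ⁺¹⁾` while `‖f (s n)‖ > 2ⁿ⁺¹`, so each atom contributes at
  -- least `1` to the integral of `‖f‖²`.
  let μ : Measure S := Measure.sum fun n : ℕ => ((2 : ℝ≥0∞)⁻¹ ^ (n + 1)) • Measure.dirac (s n)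
  have hμ : IsProbabilityMeasure μ := by
    constructor
    simp only [μ, Measure.sum_apply _ MeasurableSet.univ, Measure.smul_apply, measure_univ,
      smul_eq_mul, mul_one]
    rw [ENNReal.tsum_geometric_add_one, ENNReal.one_sub_inv_two, inv_inv,
      ENNReal.inv_mul_cancel two_ne_zero ENNReal.ofNat_ne_top]
  have hfin := (hf μ hμ).2
  rw [eLpNorm_lt_top_iff_lintegral_rpow_enorm_lt_top two_ne_zero ENNReal.ofNat_ne_top] at hfin
  refine hfin.ne ?_
  simp only [μ, lintegral_sum_measure, lintegral_smul_measure, lintegral_dirac]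
  rw [eq_top_iff, ← ENNReal.tsum_const_eq_top_of_ne_zero (α := ℕ) one_ne_zero]
  refine ENNReal.tsum_le_tsum fun n => ?_
  have h2 : (2 : ℝ≥0∞) ^ (n + 1) ≤ ‖f (s n)‖ₑ := by
    rw [← ofReal_norm]
    calc (2 : ℝ≥0∞) ^ (n + 1) = ENNReal.ofReal (2 ^ (n + 1)) := by
          rw [ENNReal.ofReal_pow zero_le_two]; simp
      _ ≤ _ := ENNReal.ofReal_le_ofReal (hs n).le
  have h3 : ‖f (s n)‖ₑ ≤ ‖f (s n)‖ₑ ^ (2 : ℝ≥0∞).toReal := by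
    simp only [ENNReal.toReal_ofNat, ENNReal.rpow_ofNat]
    exact le_self_pow ((one_le_pow₀ one_le_two).trans h2) two_ne_zero
  calc (1 : ℝ≥0∞) = (2 : ℝ≥0∞)⁻¹ ^ (n + 1) * 2 ^ (n + 1) := by
        rw [← mul_pow, ENNReal.inv_mul_cancel two_ne_zero ENNReal.ofNat_ne_top, one_pow]
    _ ≤ _ := by
        rw [smul_eq_mul]
        gcongr
        exact h2.trans h3

variable {d : ℕ} {Y : Set (E d)}
variable {H : Type*} [NormedAddCommGroup H] [InnerProductSpace ℝ H] [CompleteSpace H]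
  [RKHS ℝ H Y ℝ]

theorem inner_featureMap (f : H) (y : Y) : inner ℝ (featureMap H (y : E d)) f = f y := by
  simp [featureMap]

/-- Vanishing at infinity gives no bound near the boundary of `Y`; square integrability for every
probability measure bounds each `f`, and Banach–Steinhaus makes the bound uniform over evaluations.
-/
theorem IsC0Universal.exists_norm_featureMap_le (h : IsC0Universal H) :
    ∃ C, ∀ y : Y, ‖featureMap H (y : E d)‖ ≤ C := by
  have := banach_steinhaus (g := fun y : Y => innerSL ℝ (featureMap H (y : E d))) fun f => by
    obtain ⟨C, hC⟩ := exists_bound_of_forall_memLp fun μ hμ => (h.2 μ hμ).1 f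
    exact ⟨C, fun y => by simpa [inner_featureMap] using hC y⟩
  obtain ⟨C, hC⟩ := this
  exact ⟨C, fun y => by simpa using hC y⟩

theorem IsDifferentiableKernel.continuous_featureMap (h : IsDifferentiableKernel H) :
    Continuous fun y : Y => featureMap H (y : E d) :=
  continuous_iff_continuousAt.2 fun y =>
    ContinuousAt.comp (h y y.2).continuousAt continuous_subtype_val.continuousAt

/-- A square integrable function which is orthogonal to a dense subspace of `L²` vanishes. -/
theorem IsC0Universal.ae_eq_zero_of_integral_inner_eq_zero {S : Set (E d)} {V : Type*}
    [NormedAddCommGroup V] [InnerProductSpace ℝ V] {H : Type*} [NormedAddCommGroup H]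
    [InnerProductSpace ℝ H] [RKHS ℝ H S V] (h : IsC0Universal H)
    {μ : Measure S} [IsProbabilityMeasure μ] {g : S → V} (hg : MemLp g 2 μ)
    (h0 : ∀ f : H, ∫ x, inner ℝ (g x) (f x) ∂μ = 0) : g =ᵐ[μ] 0 := by
  obtain ⟨hH, hd⟩ := h.2 μ inferInstance
  rw [← eLpNorm_eq_zero_iff hg.1 two_ne_zero]
  -- Orthogonality gives `‖g‖ ≤ ‖g - f‖` for every `f` in `H`, and density makes the right side
  -- arbitrarily small.
  suffices hle : ∀ ε : ℝ≥0∞, ε ≠ 0 → ε ≠ ⊤ → eLpNorm g 2 μ ≤ ε by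
    refine le_antisymm (ENNReal.le_of_forall_pos_le_add fun ε hε _ => ?_) bot_le
    simpa using hle ε (by simpa using hε.ne') ENNReal.coe_ne_top
  intro ε hε hεt
  obtain ⟨f, hf⟩ := hd g hg ε hε
  have hgf : MemLp (g - (f : S → V)) 2 μ := hg.sub (hH f)
  refine le_trans ?_ hf
  have e1 : inner ℝ (hg.toLp g) ((hH f).toLp f) = (0 : ℝ) := by
    rw [L2.inner_def, ← h0 f]
    refine integral_congr_ae ?_
    filter_upwards [hg.coeFn_toLp, (hH f).coeFn_toLp] with x h1 h2
    rw [h1, h2]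
  have e2 : ‖hg.toLp g‖ ≤ ‖hgf.toLp (g - (f : S → V))‖ := by
    rw [MemLp.toLp_sub hg (hH f)]
    have := norm_sub_sq_real (hg.toLp g) ((hH f).toLp f)
    rw [e1] at this
    refine le_of_sq_le_sq ?_ (norm_nonneg _)
    rw [this]
    nlinarith [sq_nonneg ‖(hH f).toLp (f : S → V)‖]
  rw [Lp.norm_toLp, Lp.norm_toLp] at e2
  exact (ENNReal.toReal_le_toReal hg.2.ne hgf.2.ne).1 e2

end Kernels

/-! ### Marginal, conditional and joint laws. -/

section Densities

variable {dx dy : ℕ} {X : Set (E dx)} {Y : Set (E dy)}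

theorem sigmaFinite_lebesgueOn {d : ℕ} {S : Set (E d)} (hS : MeasurableSet S) :
    SigmaFinite (lebesgueOn S) := by
  refine SigmaFinite.of_map _ measurable_subtype_coe.aemeasurable ?_
  rw [lebesgueOn, (MeasurableEmbedding.subtype_coe hS).map_comap]
  infer_instance

theorem isProbabilityMeasure_marginal {rx : X → ℝ} (h : IsDensity rx) :
    IsProbabilityMeasure (marginal rx) :=
  ⟨by rw [marginal, withDensity_apply _ MeasurableSet.univ, setLIntegral_univ,
    h.lintegral_eq_one]⟩

theorem isProbabilityMeasure_conditional {q : X → E dy → ℝ} (h : IsCondDensity Y q) (x : X) :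
    IsProbabilityMeasure (conditional Y q x) :=
  ⟨by rw [conditional, withDensity_apply _ MeasurableSet.univ, setLIntegral_univ,
    h.lintegral_eq_one]⟩

theorem IsCondDensity.measurable_section {q : X → E dy → ℝ} (h : IsCondDensity Y q) (x : X) :
    Measurable fun y : Y => q x y :=
  h.measurable.comp measurable_prodMk_left

theorem integrable_conditional_iff {q : X → E dy → ℝ} (h : IsCondDensity Y q) (x : X)
    {F : Y → ℝ} : Integrable F (conditional Y q x) ↔
      Integrable (fun y : Y => q x y * F y) (lebesgueOn Y) := by
  rw [conditional, integrable_withDensity_iff_integrable_smul'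
    (h.measurable_section x).ennreal_ofReal (Eventually.of_forall fun _ => ENNReal.ofReal_lt_top)]
  simp only [ENNReal.toReal_ofReal (h.pos x _ (Subtype.coe_prop _)).le, smul_eq_mul]

theorem integral_conditional {q : X → E dy → ℝ} (h : IsCondDensity Y q) (x : X) (F : Y → ℝ) :
    ∫ y, F y ∂(conditional Y q x) = ∫ y : Y, q x y * F y ∂(lebesgueOn Y) := by
  rw [conditional, integral_withDensity_eq_integral_toReal_smul
    (h.measurable_section x).ennreal_ofReal (Eventually.of_forall fun _ => ENNReal.ofReal_lt_top)]
  simp only [ENNReal.toReal_ofReal (h.pos x _ (Subtype.coe_prop _)).le, smul_eq_mul]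

/-- Fubini's theorem for the joint law. -/
theorem integrable_conditional_and_integral_joint {rx : X → ℝ} {r : X → E dy → ℝ}
    (hX : MeasurableSet X) (hY : MeasurableSet Y) (hrx : IsDensity rx) (hr : IsCondDensity Y r)
    {F : X × Y → ℝ} (hF : Integrable F (joint Y rx r)) :
    (∀ᵐ x ∂(marginal rx), Integrable (fun y => F (x, y)) (conditional Y r x)) ∧
      ∫ z, F z ∂(joint Y rx r) = ∫ x, ∫ y, F (x, y) ∂(conditional Y r x) ∂(marginal rx) := by
  have := sigmaFinite_lebesgueOn hX
  have := sigmaFinite_lebesgueOn hY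
  have hm : Measurable fun z : X × Y => ENNReal.ofReal (r z.1 z.2 * rx z.1) :=
    (hr.measurable.mul (hrx.measurable.comp measurable_fst)).ennreal_ofReal
  have hlt : ∀ᵐ z ∂((lebesgueOn X).prod (lebesgueOn Y)),
      ENNReal.ofReal (r z.1 z.2 * rx z.1) < ⊤ := Eventually.of_forall fun _ => ENNReal.ofReal_lt_top
  have hnn : ∀ z : X × Y, (ENNReal.ofReal (r z.1 z.2 * rx z.1)).toReal = r z.1 z.2 * rx z.1 :=
    fun z => ENNReal.toReal_ofReal (mul_nonneg (hr.pos _ _ z.2.2).le (hrx.nonneg _))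
  rw [joint, integrable_withDensity_iff_integrable_smul' hm hlt] at hF
  rw [joint, integral_withDensity_eq_integral_toReal_smul hm hlt]
  simp only [hnn, smul_eq_mul] at hF ⊢
  constructor
  -- Points with `rx x = 0` are null for the marginal, so the factor `rx x` can be divided out.
  · rw [marginal, ae_withDensity_iff hrx.measurable.ennreal_ofReal]
    filter_upwards [hF.prod_right_ae] with x hx hne
    have hpos : 0 < rx x := by simpa using hne
    rw [integrable_conditional_iff hr]
    refine (hx.const_mul (rx x)⁻¹).congr (Eventually.of_forall fun y => ?_)
    field_simp
  · rw [integral_prod _ hF, marginal, integral_withDensity_eq_integral_toReal_smul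
      hrx.measurable.ennreal_ofReal (Eventually.of_forall fun _ => ENNReal.ofReal_lt_top)]
    refine integral_congr_ae (Eventually.of_forall fun x => ?_)
    simp only [integral_conditional hr, ENNReal.toReal_ofReal (hrx.nonneg x), smul_eq_mul,
      ← integral_const_mul]
    refine integral_congr_ae (Eventually.of_forall fun y => ?_)
    ring

end Densities

/-! ### Stein identity and comparison of `ξ_p` with `ξ_r`. -/

section Stein

variable {dx dy : ℕ} {X : Set (E dx)} {Y : Set (E dy)}
variable {Hl : Type*} [NormedAddCommGroup Hl] [InnerProductSpace ℝ Hl] [CompleteSpace Hl]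
  [RKHS ℝ Hl Y ℝ]

theorem gradient_apply_eq_fderiv {d : ℕ} (f : E d → ℝ) (y : E d) (i : Fin d) :
    gradient f y i = fderiv ℝ f y (EuclideanSpace.single i 1) := by
  rw [← InnerProductSpace.toDual_symm_apply (𝕜 := ℝ), ← gradient, EuclideanSpace.inner_single_right]
  simp

theorem score_apply {q : X → E dy → ℝ} (hq : IsCondDensity Y q) (x : X) {y : E dy} (hy : y ∈ Y)
    (i : Fin dy) :
    score q x y i = (q x y)⁻¹ * fderiv ℝ (q x) y (EuclideanSpace.single i 1) := by
  rw [score, gradient_apply_eq_fderiv, fderiv.log (hq.differentiableAt x y hy) (hq.pos x y hy).ne']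
  simp

/-- The Stein identity on the whole space needs no boundary condition. -/
theorem steinIdentity_univ {r : X → E dy → ℝ} (rx : X → ℝ) (hY : Y = Set.univ)
    (hr : IsCondDensity Y r) (hl : IsDifferentiableKernel Hl) (hu : IsC0Universal Hl) :
    SteinIdentity Hl r rx := by
  refine Eventually.of_forall fun x f hf => ?_
  have hmem : ∀ y, y ∈ Y := fun y => hY ▸ Set.mem_univ y
  have hYm : MeasurableSet Y := hY ▸ MeasurableSet.univ
  have hemb : MeasurableEmbedding (Subtype.val : Y → E dy) := MeasurableEmbedding.subtype_coe hYm
  -- This is the field `r f`, by the reproducing property; `r ∇ log r = ∇ r` identifies its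
  -- divergence with `r ⟪ξ_r, f⟫`. It is integrable because the feature map is bounded.
  let F : Fin dy → E dy → ℝ := fun i y => r x y * inner ℝ (featureMap Hl y) (f i)
  have hrd : Differentiable ℝ (r x) := fun y => hr.differentiableAt x y (hmem y)
  have hld : Differentiable ℝ (featureMap Hl) := fun y => hl y (hmem y)
  have hfd : ∀ i, Differentiable ℝ fun y => inner ℝ (featureMap Hl y) (f i) := fun i =>
    hld.inner ℝ (differentiable_const _)
  have hdiv : ∀ y, ∑ i, fderiv ℝ (F i) y (EuclideanSpace.single i 1)
      = r x y * inner ℝ (xi Hl r x y) f := by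
    intro y
    rw [PiLp.inner_apply, Finset.mul_sum]
    refine Finset.sum_congr rfl fun i _ => ?_
    have h1 := (hrd y).hasFDerivAt.mul ((hld y).hasFDerivAt.inner ℝ (hasFDerivAt_const (f i) y))
    have hpos := hr.pos x y (hmem y)
    rw [HasFDerivAt.fderiv (f := F i) h1]
    simp [xi, score_apply hr x (hmem y), inner_add_left, inner_smul_left]
    field_simp
    ring
  have hint : ∀ G : E dy → ℝ, Integrable (fun y : Y => G y) (lebesgueOn Y) ↔ Integrable G := by
    intro G
    rw [lebesgueOn, ← Function.comp_def G, ← hemb.integrable_map_iff, hemb.map_comap]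
    simp [hY]
  have hri : Integrable (r x) := by
    rw [← hint]
    refine ⟨(hr.measurable_section x).aestronglyMeasurable, ?_⟩
    rw [hasFiniteIntegral_iff_ofReal (Eventually.of_forall fun y : Y => (hr.pos x y y.2).le),
      hr.lintegral_eq_one]
    exact ENNReal.one_lt_top
  have hFi : ∀ i, Integrable (F i) := by
    intro i
    obtain ⟨C, hC⟩ := hu.exists_norm_featureMap_le
    refine hri.mul_bdd (c := C * ‖f i‖) (hfd i).continuous.aestronglyMeasurable
      (Eventually.of_forall fun y => ?_)
    exact (norm_inner_le_norm _ _).trans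
      (mul_le_mul_of_nonneg_right (hC ⟨y, hmem y⟩) (norm_nonneg _))
  have key := integral_divergence_eq_zero F (fun i => hrd.mul (hfd i)) hFi
  simp only [hdiv] at key
  rw [integral_conditional hr, lebesgueOn,
    integral_subtype_comap hYm (fun y => r x y * inner ℝ (xi Hl r x y) f),
    show volume.restrict Y = volume by rw [hY, Measure.restrict_univ]]
  rw [integrable_conditional_iff hr, hint fun y => r x y * inner ℝ (xi Hl r x y) f] at hf
  exact key hf

theorem xi_eq_add {p r : X → E dy → ℝ} (hp : IsCondDensity Y p) (hr : IsCondDensity Y r) (x : X)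
    {y : E dy} (hY : IsOpen Y) (hy : y ∈ Y) (i : Fin dy) :
    xi Hl p x y i = xi Hl r x y i +
      gradient (fun y' => Real.log (p x y' / r x y')) y i • featureMap Hl y := by
  have heq : (fun y' => Real.log (p x y' / r x y')) =ᶠ[𝓝 y]
      fun y' => Real.log (p x y') - Real.log (r x y') := by
    filter_upwards [hY.mem_nhds hy] with z hz
    exact Real.log_div (hp.pos x z hz).ne' (hr.pos x z hz).ne'
  have hg : gradient (fun y' => Real.log (p x y' / r x y')) y i = score p x y i - score r x y i := by
    rw [score, score, gradient_apply_eq_fderiv, gradient_apply_eq_fderiv, gradient_apply_eq_fderiv,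
      heq.fderiv_eq, fderiv_fun_sub]
    · simp
    · exact (hp.differentiableAt x y hy).log (hp.pos x y hy).ne'
    · exact (hr.differentiableAt x y hy).log (hr.pos x y hy).ne'
  simp only [hg, xi, sub_smul]
  abel

theorem xi_congr {p r : X → E dy → ℝ} {x : X} {y : E dy} (hY : IsOpen Y) (hy : y ∈ Y)
    (h : ∀ y ∈ Y, p x y = r x y) : xi Hl p x y = xi Hl r x y := by
  have : (fun y' => Real.log (p x y')) =ᶠ[𝓝 y] fun y' => Real.log (r x y') := by
    filter_upwards [hY.mem_nhds hy] with z hz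
    rw [h z hz]
  have hs : score p x y = score r x y := by
    ext i
    rw [score, score, gradient_apply_eq_fderiv, gradient_apply_eq_fderiv, this.fderiv_eq]
  simp only [xi, hs]

end Stein

/-! ### The witness determines the conditional density. -/

section Witness

variable {dx dy : ℕ} {X : Set (E dx)} {Y : Set (E dy)}
variable {Hl : Type*} [NormedAddCommGroup Hl] [InnerProductSpace ℝ Hl] [CompleteSpace Hl]
  [RKHS ℝ Hl Y ℝ]

/-- The difference `∇_y log (p(y|x) / r(y|x))` of the conditional scores. -/
noncomputable def scoreDiff (p r : X → E dy → ℝ) (x : X) (y : E dy) : E dy :=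
  gradient (fun y' => Real.log (p x y' / r x y')) y

theorem memLp_scoreDiff {p r : X → E dy → ℝ} {x : X}
    (h : ∫⁻ y : Y, ‖scoreDiff p r x y‖ₑ ^ 2 ∂(conditional Y r x) < ⊤) (i : Fin dy) :
    MemLp (fun y : Y => scoreDiff p r x y i) 2 (conditional Y r x) := by
  have hm : Measurable fun y : Y => scoreDiff p r x y i := by
    simp only [scoreDiff, gradient_apply_eq_fderiv]
    exact (measurable_fderiv_apply_const ℝ _ _).comp measurable_subtype_coe
  refine ⟨hm.aestronglyMeasurable, ?_⟩
  rw [eLpNorm_lt_top_iff_lintegral_rpow_enorm_lt_top two_ne_zero ENNReal.ofNat_ne_top]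
  refine lt_of_le_of_lt (lintegral_mono fun y => ?_) h
  simp only [ENNReal.toReal_ofNat, ENNReal.rpow_ofNat]
  gcongr
  exact enorm_le_iff_norm_le.2 (PiLp.norm_apply_le _ i)

/-- `L²` lies in `L¹` for a probability measure, and the feature map is bounded and continuous. -/
theorem integrable_scoreDiff_smul_featureMap {p r : X → E dy → ℝ} (hr : IsCondDensity Y r)
    (hl : IsDifferentiableKernel Hl) (hu : IsC0Universal Hl) {x : X}
    (h : ∫⁻ y : Y, ‖scoreDiff p r x y‖ₑ ^ 2 ∂(conditional Y r x) < ⊤) (i : Fin dy) :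
    Integrable (fun y : Y => scoreDiff p r x y i • featureMap Hl (y : E dy))
      (conditional Y r x) := by
  have := isProbabilityMeasure_conditional hr x
  have h1 := (memLp_scoreDiff h i).integrable one_le_two
  obtain ⟨C, hC⟩ := hu.exists_norm_featureMap_le
  refine (h1.norm.mul_const C).mono'
    (h1.aestronglyMeasurable.smul hl.continuous_featureMap.aestronglyMeasurable)
    (Eventually.of_forall fun y => ?_)
  rw [norm_smul]
  exact mul_le_mul_of_nonneg_left (hC y) (norm_nonneg _)

/-- If `r(·|x)` satisfies the Stein identity, then the expectation of `⟪ξ_{p|x}, f⟫` is the pairing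
of `f` with the expectation of `l(y, ·) ∇_y log (p(y|x) / r(y|x))`. -/
theorem integral_inner_xi {p r : X → E dy → ℝ} (hY : IsOpen Y)
    (hp : IsCondDensity Y p) (hr : IsCondDensity Y r)
    (hl : IsDifferentiableKernel Hl) (hu : IsC0Universal Hl) {x : X}
    (h : ∫⁻ y : Y, ‖scoreDiff p r x y‖ₑ ^ 2 ∂(conditional Y r x) < ⊤)
    (hs : ∀ f : PiSpace Hl dy,
      Integrable (fun y : Y => inner ℝ (xi Hl r x y) f) (conditional Y r x) →
      ∫ y : Y, inner ℝ (xi Hl r x y) f ∂(conditional Y r x) = 0)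
    (f : PiSpace Hl dy)
    (hf : Integrable (fun y : Y => inner ℝ (xi Hl p x y) f) (conditional Y r x)) :
    ∫ y : Y, inner ℝ (xi Hl p x y) f ∂(conditional Y r x) =
      ∑ i, inner ℝ (∫ y : Y, scoreDiff p r x y i • featureMap Hl (y : E dy) ∂(conditional Y r x))
        (f i) := by
  have hi := integrable_scoreDiff_smul_featureMap hr hl hu h
  have hi' : ∀ i, Integrable (fun y : Y => inner ℝ (scoreDiff p r x y i • featureMap Hl (y : E dy))
      (f i)) (conditional Y r x) := fun i => (hi i).inner_const (f i)
  have hsplit : ∀ y : Y, inner ℝ (xi Hl p x y) f = inner ℝ (xi Hl r x y) f +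
      ∑ i, inner ℝ (scoreDiff p r x y i • featureMap Hl (y : E dy)) (f i) := by
    intro y
    simp only [PiLp.inner_apply, ← Finset.sum_add_distrib, ← inner_add_left]
    refine Finset.sum_congr rfl fun i _ => ?_
    rw [xi_eq_add hp hr x hY y.2]
    rfl
  have hsum := integrable_finsetSum Finset.univ fun i _ => hi' i
  -- The Stein identity covers only those `f` whose expectation exists; existence is inherited from
  -- `ξ_p`, the difference being integrable.
  have hr' : Integrable (fun y : Y => inner ℝ (xi Hl r x y) f) (conditional Y r x) := by
    refine (hf.sub hsum).congr (Eventually.of_forall fun y => ?_)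
    simp [hsplit]
  simp only [hsplit]
  rw [integral_add hr' hsum, hs f hr', zero_add, integral_finsetSum _ fun i _ => hi' i]
  refine Finset.sum_congr rfl fun i _ => ?_
  rw [real_inner_comm, ← integral_inner (hi i)]
  simp only [real_inner_comm]

/-- Under the Stein identity, the Stein witness function is the Bochner expectation of
`l(y, ·) ∇_y log (p(y|x) / r(y|x))`. -/
theorem witness_apply_eq_integral {p r : X → E dy → ℝ} (hY : IsOpen Y)
    (hp : IsCondDensity Y p) (hr : IsCondDensity Y r)
    (hl : IsDifferentiableKernel Hl) (hu : IsC0Universal Hl) {x : X}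
    (h : ∫⁻ y : Y, ‖scoreDiff p r x y‖ₑ ^ 2 ∂(conditional Y r x) < ⊤)
    (hs : ∀ f : PiSpace Hl dy,
      Integrable (fun y : Y => inner ℝ (xi Hl r x y) f) (conditional Y r x) →
      ∫ y : Y, inner ℝ (xi Hl r x y) f ∂(conditional Y r x) = 0)
    {g : PiSpace Hl dy} (hg : ∀ (w : Y) (i : Fin dy),
      Integrable (fun y : Y => (xi Hl p x y i : Hl) w) (conditional Y r x) ∧
      (g i : Hl) w = ∫ y : Y, (xi Hl p x y i : Hl) w ∂(conditional Y r x)) (i : Fin dy) :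
    g i = ∫ y : Y, scoreDiff p r x y i • featureMap Hl (y : E dy) ∂(conditional Y r x) := by
  refine RKHS.ext (𝕜 := ℝ) fun w => ?_
  -- Testing against `l(w, ·)` in slot `i` evaluates the `i`-th component at `w`.
  have hsingle : ∀ (a : PiSpace Hl dy),
      inner ℝ a (WithLp.toLp 2 (Pi.single i (featureMap Hl (w : E dy))) : PiSpace Hl dy)
        = (a i : Hl) w := by
    intro a
    rw [PiLp.inner_apply, Finset.sum_eq_single i]
    · simp only [Pi.single_eq_same]
      rw [real_inner_comm, inner_featureMap]
    · intro j _ hj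
      simp [Pi.single_eq_of_ne hj]
    · simp
  have key := integral_inner_xi hY hp hr hl hu h hs
    (WithLp.toLp 2 (Pi.single i (featureMap Hl (w : E dy)))) (by
      simp only [hsingle]
      exact (hg w i).1)
  simp only [hsingle] at key
  rw [(hg w i).2, key]
  exact hsingle (WithLp.toLp 2 fun i => ∫ y : Y, scoreDiff p r x y i • featureMap Hl (y : E dy)
    ∂(conditional Y r x))

/-- If the expectation of `l(y, ·) ∇_y log (p(y|x) / r(y|x))` vanishes, then the two conditional
densities at `x` agree. -/
theorem eq_of_integral_scoreDiff_smul_featureMap_eq_zero {p r : X → E dy → ℝ} (hY : IsOpen Y)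
    (hYc : IsConnected Y) (hp : IsCondDensity Y p) (hr : IsCondDensity Y r)
    (hl : IsDifferentiableKernel Hl) (hu : IsC0Universal Hl) {x : X}
    (h : ∫⁻ y : Y, ‖scoreDiff p r x y‖ₑ ^ 2 ∂(conditional Y r x) < ⊤)
    (h0 : ∀ i, ∫ y : Y, scoreDiff p r x y i • featureMap Hl (y : E dy) ∂(conditional Y r x) = 0)
    {y : E dy} (hy : y ∈ Y) : p x y = r x y := by
  have := isProbabilityMeasure_conditional hr x
  have hδ : ∀ i, ∀ᵐ y : Y ∂(conditional Y r x), scoreDiff p r x y i = 0 := by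
    intro i
    refine hu.ae_eq_zero_of_integral_inner_eq_zero (memLp_scoreDiff h i) fun f => ?_
    have := integral_inner (𝕜 := ℝ) (integrable_scoreDiff_smul_featureMap hr hl hu h i) f
    rw [h0 i, inner_zero_right] at this
    rw [← this]
    refine integral_congr_ae (Eventually.of_forall fun y => ?_)
    have e : inner ℝ f (featureMap Hl (y : E dy)) = f y := by
      rw [real_inner_comm, inner_featureMap]
    simp [inner_smul_right, e, mul_comm]
  let L : E dy → ℝ := fun y' => Real.log (p x y' / r x y')
  have hpr : ∀ z ∈ Y, 0 < p x z / r x z := fun z hz => div_pos (hp.pos x z hz) (hr.pos x z hz)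
  have hLd : ∀ z ∈ Y, DifferentiableAt ℝ L z := fun z hz => by
    refine DifferentiableAt.log ?_ (hpr z hz).ne'
    simp only [div_eq_mul_inv]
    exact (hp.differentiableAt x z hz).mul
      ((hr.differentiableAt x z hz).fun_inv (hr.pos x z hz).ne')
  have hae : ∀ᵐ z ∂(volume : Measure (E dy)), z ∈ Y → fderiv ℝ L z = 0 := by
    -- Since `r > 0` on `Y`, null sets of the conditional law are Lebesgue null.
    have h1 : ∀ᵐ z : Y ∂(lebesgueOn Y), scoreDiff p r x z = 0 := by
      have h2 := ae_all_iff.2 hδ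
      rw [conditional, ae_withDensity_iff (hr.measurable_section x).ennreal_ofReal] at h2
      filter_upwards [h2] with z hz
      ext i
      exact hz (by simpa using hr.pos x z z.2) i
    rw [lebesgueOn, ← (MeasurableEmbedding.subtype_coe hY.measurableSet).ae_map_iff
      (p := fun z => scoreDiff p r x z = 0),
      (MeasurableEmbedding.subtype_coe hY.measurableSet).map_comap, Subtype.range_coe,
      ae_restrict_iff' hY.measurableSet] at h1
    filter_upwards [h1] with z hz hzY
    have := hz hzY
    simpa [scoreDiff, gradient] using this
  obtain ⟨c, hc⟩ : ∃ c, ∀ z ∈ Y, p x z = c * r x z := by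
    refine ⟨p x y / r x y, fun z hz => ?_⟩
    have hL := eq_of_ae_fderiv_eq_zero volume hY hYc.isPreconnected hLd hae hz hy
    rw [← Real.log_injOn_pos (hpr z hz) (hpr y hy) hL, div_mul_cancel₀ _ (hr.pos x z hz).ne']
  have hc1 : c = 1 := by
    have e1 := hp.lintegral_eq_one x
    have hc0 : 0 < c := by
      have := hp.pos x y hy
      rw [hc y hy] at this
      exact pos_of_mul_pos_left this (hr.pos x y hy).le
    have e2 : ∀ z : Y, ENNReal.ofReal (p x z) = ENNReal.ofReal c * ENNReal.ofReal (r x z) :=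
      fun z => by rw [hc z z.2, ENNReal.ofReal_mul hc0.le]
    simp only [e2] at e1
    rw [lintegral_const_mul _ (hr.measurable_section x).ennreal_ofReal, hr.lintegral_eq_one,
      mul_one] at e1
    simpa using e1
  rw [hc y hy, hc1, one_mul]

end Witness

/-! ### The discrepancy tested against `HK`. -/

section Discrepancy

variable {dx dy : ℕ} {X : Set (E dx)} {Y : Set (E dy)}
variable {Hl : Type*} [NormedAddCommGroup Hl] [InnerProductSpace ℝ Hl] [CompleteSpace Hl]
  [RKHS ℝ Hl Y ℝ]
variable {HK : Type*} [NormedAddCommGroup HK] [InnerProductSpace ℝ HK] [CompleteSpace HK]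
  [RKHS ℝ HK X (PiSpace Hl dy)]

/-- The pairing of an element of `HK` with the mean embedding defining the discrepancy is an
iterated expectation. -/
theorem inner_integral_kerFun_xi {p r : X → E dy → ℝ} {rx : X → ℝ}
    (hX : MeasurableSet X) (hY : MeasurableSet Y) (hrx : IsDensity rx) (hr : IsCondDensity Y r)
    (hb : Integrable (fun z : X × Y => RKHS.kerFun HK z.1 (xi Hl p z.1 z.2)) (joint Y rx r))
    (h : HK) :
    (∀ᵐ x ∂(marginal rx),
      Integrable (fun y : Y => inner ℝ (xi Hl p x y) (h x)) (conditional Y r x)) ∧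
    inner ℝ h (∫ z : X × Y, RKHS.kerFun HK z.1 (xi Hl p z.1 z.2) ∂(joint Y rx r)) =
      ∫ x, ∫ y : Y, inner ℝ (xi Hl p x y) (h x) ∂(conditional Y r x) ∂(marginal rx) := by
  -- The reproducing property `⟪K_x v, h⟫ = ⟪v, h x⟫` reduces the matter to Fubini for a scalar
  -- function.
  have hi : Integrable (fun z : X × Y => inner ℝ (xi Hl p z.1 z.2) (h z.1)) (joint Y rx r) := by
    refine (hb.inner_const h).congr (Eventually.of_forall fun z => ?_)
    simp
  have := integrable_conditional_and_integral_joint hX hY hrx hr hi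
  refine ⟨this.1, ?_⟩
  rw [← this.2, ← integral_inner hb]
  refine integral_congr_ae (Eventually.of_forall fun z => ?_)
  simp only [RKHS.inner_kerFun]
  exact real_inner_comm _ _

end Discrepancy

end KCSD

open MeasureTheory Filter KCSD in
theorem theorem1 {dx dy : ℕ}
    -- the domains of the covariate and of the response
    (X : Set (KCSD.E dx)) (hX : MeasurableSet X)
    (Y : Set (KCSD.E dy)) (hYopen : IsOpen Y) (hYconn : IsConnected Y)
    -- the kernel `l` and its RKHS `Hl`
    (l : Y → Y → ℝ)
    (Hl : Type*) [NormedAddCommGroup Hl] [InnerProductSpace ℝ Hl] [CompleteSpace Hl]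
    [RKHS ℝ Hl Y ℝ] (hl : ∀ y y' : Y, RKHS.kernel Hl y y' (1 : ℝ) = l y y')
    (hldiff : KCSD.IsDifferentiableKernel Hl)
    -- the operator-valued kernel `K` and its RKHS `HK`
    (K : X → X → (KCSD.PiSpace Hl dy →L[ℝ] KCSD.PiSpace Hl dy))
    (HK : Type*) [NormedAddCommGroup HK] [InnerProductSpace ℝ HK] [CompleteSpace HK]
    [RKHS ℝ HK X (KCSD.PiSpace Hl dy)] (hK : ∀ x x' : X, RKHS.kernel HK x x' = K x x')
    -- the density of the covariate, the conditional model and the conditional density of the data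
    (rx : X → ℝ) (hrx : KCSD.IsDensity rx)
    (p r : X → KCSD.E dy → ℝ)
    (hp : KCSD.IsCondDensity Y p) (hr : KCSD.IsCondDensity Y r)
    -- boundary condition, needed only if `Y` is not the whole space
    (hbd : Y = Set.univ ∨ KCSD.SteinIdentity Hl r rx)
    -- `C₀`-universality of both kernels
    (hKuniv : KCSD.IsC0Universal HK) (hluniv : KCSD.IsC0Universal Hl)
    -- the essentially bounded conditional score-difference moment
    (hscore : essSup (fun x : X => ∫⁻ y : Y,
        ‖gradient (fun y' => Real.log (p x y' / r x y')) (y : KCSD.E dy)‖ₑ ^ 2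
          ∂(KCSD.conditional Y r x)) (KCSD.marginal rx) < ⊤)
    -- the conditional Stein witness function and its square integrability
    (g : X → KCSD.PiSpace Hl dy) (hg : KCSD.IsSteinWitness Hl p r rx g)
    (hgL2 : MeasureTheory.MemLp g 2 (KCSD.marginal rx))
    -- Bochner integrability
    (hbochner : MeasureTheory.Integrable
      (fun z : X × Y => RKHS.kerFun HK z.1 (KCSD.xi Hl p z.1 z.2)) (KCSD.joint Y rx r)) :
    KCSD.kcsd Hl HK p r rx = 0 ↔
      ∀ᵐ x ∂(KCSD.marginal rx), ∀ y ∈ Y, p x y = r x y := by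
  have hYm := hYopen.measurableSet
  have := isProbabilityMeasure_marginal hrx
  have hstein : SteinIdentity Hl r rx :=
    hbd.elim (fun hY => steinIdentity_univ rx hY hr hldiff hluniv) id
  have hkey := fun h : HK =>
    inner_integral_kerFun_xi hX hYm hrx hr hbochner h
  rw [kcsd, sq_eq_zero_iff, norm_eq_zero]
  constructor
  · intro hD
    have hgx : ∀ᵐ x ∂(marginal rx), ∀ i, g x i =
        ∫ y : Y, scoreDiff p r x y i • featureMap Hl (y : E dy) ∂(conditional Y r x) := by
      filter_upwards [hg, hstein, ae_lt_of_essSup_lt hscore] with x h1 h2 h3 i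
      exact witness_apply_eq_integral hYopen hp hr hldiff hluniv h3 h2 h1 i
    have hg0 : g =ᵐ[marginal rx] 0 := by
      refine hKuniv.ae_eq_zero_of_integral_inner_eq_zero hgL2 fun h => ?_
      have h1 := (hkey h).2
      rw [hD, inner_zero_right] at h1
      rw [h1]
      refine integral_congr_ae ?_
      filter_upwards [hgx, hstein, ae_lt_of_essSup_lt hscore, (hkey h).1] with x h2 h3 h4 h5
      rw [integral_inner_xi hYopen hp hr hldiff hluniv h4 h3 _ h5, PiLp.inner_apply]
      simp only [h2]
    filter_upwards [hgx, hg0, ae_lt_of_essSup_lt hscore] with x h1 h2 h3 y hy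
    refine eq_of_integral_scoreDiff_smul_featureMap_eq_zero hYopen hYconn hp hr hldiff hluniv h3
      (fun i => ?_) hy
    rw [← h1 i, h2]
    rfl
  · intro heq
    refine ext_inner_left ℝ fun h => ?_
    rw [(hkey h).2, inner_zero_right]
    refine integral_eq_zero_of_ae ?_
    filter_upwards [heq, hstein, (hkey h).1] with x h1 h2 h3
    have hxi : ∀ y : Y, xi Hl p x y = xi Hl r x y := fun y => xi_congr hYopen y.2 h1
    simp only [hxi] at h3 ⊢
    exact h2 _ h3
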